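/- **Setting.** Every $x\in[0,\infty)$ is identified with its sequence of binary digits $(x_j)_{j\in\mathbb Z}$, $x=\sum_j x_j2^j$, where dyadic rationals get the terminating expansion; $\oplus=\ominus$ is digitwise addition modulo $2$, and multiplication by $2$ is the shift of digits. As a point of the segment $[0,1]$, the right end point is written $1=0.111\ldots_2$, so that $2\cdot 1\ominus 1=1$. For $x,y\in[0,1]$, $y\ominus x$ denotes the number represented by the digitwise difference of the two expansions. Let $f:[0,1]\to\mathbb R^N$. * $f$ is *$W$-continuous* if for every $x\in[0,1]$ one has $f(y)\to f(x)$ as $y\ominus x\to 0$, $y\in[0,1]$ (that is, $f(x\oplus h)\to f(x)$ as $h\to0$). * The dyadic modulus of continuity is $w(f,\delta)=\sup\{\|f(y)-f(x)\| : x,y\in[0,1],\ y\ominus x<\delta\}$, and the dyadic Hölder exponent $\alpha_f$ is the supremum (possibly $+\infty$) of all $\alpha>0$ for which there is a constant $C=C(f,\alpha)$ with $w(f,\delta)\le C\delta^\alpha$ for all $\delta>0$. * For affine operators $A_0,A_1$ on $\mathbb R^N$ with linear parts $L_0,L_1$, the joint spectral radius is $\rho=\rho(A_0,A_1)=\lim_{r\to\infty}\max_{d\in\{0,1\}^r}\|L_{d_1}\cdots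 L_{d_r}\|^{1/r}$. We put $-\log_2 0=+\infty$. **Theorem.** Let $A_0,A_1$ be affine operators on $\mathbb R^N$ with $\rho=\rho(A_0,A_1)<1$. Then the self-similarity equation $$v(t)=\begin{cases}A_0\,v(2t), & t\in[0,\tfrac12),\\ A_1\,v(2t\ominus1), & t\in[\tfrac12,1],\end{cases}$$ has a $W$-continuous solution $v:[0,1]\to\mathbb R^N$. Every $W$-continuous solution $v$ satisfies $\alpha_v\ge-\log_2\rho$. If, moreover, $A_0,A_1$ have no common invariant affine subspace (nonempty, possibly a single point, and different from $\mathbb R^N$), then $\alpha_v=-\log_2\rho$. In particular, no cross (Barnsley) condition on $A_0,A_1$ is assumed. -/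

import Mathlib

open Filter Topology

open scoped ENNReal

namespace DyadicCurve

noncomputable section

/-! ### Dyadic arithmetic

A doubly infinite sequence of binary digits; the digit `a j` belongs to `2 ^ j`.  Digitwise binary
addition `⊕` is the pointwise addition of `ℤ → ZMod 2`, and `⊖` (which coincides with `⊕`) is the
pointwise subtraction. -/

/-- Sequences of binary digits indexed by `ℤ`, with digitwise addition `⊕`. -/
abbrev DigitSeq : Type := ℤ → ZMod 2

/-- The number `∑ j, a j * 2 ^ j` represented by a sequence of binary digits. -/
def value (a : DigitSeq) : ℝ := ∑' j : ℤ, ((a j).val : ℝ) * (2 : ℝ) ^ j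

/-- The binary expansion of a real `x ≥ 0`; dyadic rationals get the terminating expansion. -/
def expansion (x : ℝ) : DigitSeq := fun j => ((⌊x * (2 : ℝ) ^ (-j)⌋ : ℤ) : ZMod 2)

/-- The binary expansion of a point of the segment `[0, 1]`, all of whose digits stand after the
binary point: the usual (terminating, if possible) expansion for `x < 1`, and
`1 = 0.111…` at the right end point. -/
def unitExpansion (x : ℝ) : DigitSeq :=
  if x = 1 then fun j => if j < 0 then 1 else 0 else expansion x

/-- Multiplication by two: the shift of the binary digits. -/
def double (a : DigitSeq) : DigitSeq := fun j => a (j - 1)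

/-- The point `2t ⊖ 1`, for `t` in `[1/2, 1]`. -/
def doubleSubOne (t : ℝ) : ℝ := value (double (unitExpansion t) - expansion 1)

/-- The size `x ⊖ y` of the digitwise difference of two points of `[0, 1]`. -/
def dyadicDist (x y : ℝ) : ℝ := value (unitExpansion x - unitExpansion y)

/-! ### Continuity and smoothness on the dyadic segment -/

variable {E : Type*} [NormedAddCommGroup E]

/-- `W`-continuity on `[0, 1]`: `f (x ⊕ h) → f x` as `h → 0`, at every point `x` of `[0, 1]`.
Here `y = x ⊕ h` runs over the points of `[0, 1]`, and `h = y ⊖ x`. -/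
def WContinuous (f : ℝ → E) : Prop :=
  ∀ x ∈ Set.Icc (0 : ℝ) 1, ∀ ε > 0, ∃ δ > 0, ∀ y ∈ Set.Icc (0 : ℝ) 1,
    dyadicDist y x < δ → ‖f y - f x‖ < ε

/-- The dyadic modulus of continuity on `[0, 1]`:
the supremum of `‖f (x ⊕ h) - f x‖` over `x`, `x ⊕ h = y` in `[0, 1]` with `h = y ⊖ x < δ`. -/
def dyadicModulus (f : ℝ → E) (δ : ℝ) : ℝ≥0∞ :=
  ⨆ (x ∈ Set.Icc (0 : ℝ) 1) (y ∈ Set.Icc (0 : ℝ) 1) (_ : dyadicDist y x < δ), ‖f y - f x‖ₑ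

/-- The dyadic Hölder exponent: the supremum (possibly `+∞`) of all `α > 0` such that
`w (f, δ) ≤ C * δ ^ α` for all `δ > 0`, with a constant `C` depending only on `f` and `α`. -/
def holderExponent (f : ℝ → E) : EReal :=
  sSup ((fun α : ℝ => (α : EReal)) '' {α : ℝ | 0 < α ∧ ∃ C : ℝ, ∀ δ : ℝ, 0 < δ →
    dyadicModulus f δ ≤ ENNReal.ofReal (C * δ ^ α)})

/-- `-log₂ ρ` for `ρ ≥ 0`, with the value `+∞` at `ρ = 0`. -/
def negLogTwo (ρ : ℝ) : EReal := if ρ = 0 then ⊤ else ((-Real.logb 2 ρ : ℝ) : EReal)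

/-! ### Pairs of affine operators -/

variable [NormedSpace ℝ E]

/-- The self-similarity equation on `[0, 1]`:
`v t = A₀ (v (2t))` on `[0, 1/2)` and `v t = A₁ (v (2t ⊖ 1))` on `[1/2, 1]`. -/
def IsSelfSimilar (A₀ A₁ : E →ᵃ[ℝ] E) (v : ℝ → E) : Prop :=
  (∀ t ∈ Set.Ico (0 : ℝ) (1 / 2), v t = A₀ (v (2 * t))) ∧
    ∀ t ∈ Set.Icc (1 / 2 : ℝ) 1, v t = A₁ (v (doubleSubOne t))

/-- `A₀` and `A₁` have a common invariant affine subspace: a nonempty affine subspace, different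
from the whole space, which both operators map to itself. Single points are included. -/
def HasCommonInvariantSubspace (A₀ A₁ : E →ᵃ[ℝ] E) : Prop :=
  ∃ M : AffineSubspace ℝ E, (M : Set E).Nonempty ∧ M ≠ ⊤ ∧
    (∀ x ∈ M, A₀ x ∈ M) ∧ ∀ x ∈ M, A₁ x ∈ M

variable [FiniteDimensional ℝ E]

/-- The linear part of an affine operator, as a bounded operator. -/
def linearPart (A : E →ᵃ[ℝ] E) : E →L[ℝ] E := LinearMap.toContinuousLinearMap A.linear

/-- The largest operator norm of a product of `r` factors, each of which is the linear part of
`A₀` or of `A₁`. -/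
def maxProductNorm (A₀ A₁ : E →ᵃ[ℝ] E) (r : ℕ) : ℝ :=
  ⨆ d : Fin r → Fin 2, ‖(List.ofFn fun i => ![linearPart A₀, linearPart A₁] (d i)).prod‖

/-- The joint spectral radius of two affine operators (that is, of their linear parts):
the limit of `max ‖A_{d₁} ⋯ A_{d_r}‖ ^ (1 / r)` over all words of length `r`, as `r → ∞`. -/
def jointSpectralRadius (A₀ A₁ : E →ᵃ[ℝ] E) : ℝ :=
  limUnder atTop fun r : ℕ => maxProductNorm A₀ A₁ r ^ (1 / (r : ℝ))

theorem maxProductNorm_nonneg (A₀ A₁ : E →ᵃ[ℝ] E) (r : ℕ) : 0 ≤ maxProductNorm A₀ A₁ r :=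
  Real.iSup_nonneg fun _ => norm_nonneg _

theorem maxProductNorm_add_le (A₀ A₁ : E →ᵃ[ℝ] E) (m n : ℕ) :
    maxProductNorm A₀ A₁ (m + n) ≤ maxProductNorm A₀ A₁ m * maxProductNorm A₀ A₁ n := by
  refine ciSup_le fun d => ?_
  rw [List.ofFn_add, List.prod_append]
  refine (norm_mul_le _ _).trans (mul_le_mul ?_ ?_ (norm_nonneg _) (maxProductNorm_nonneg _ _ _))
  · exact le_ciSup (f := fun d : Fin m → Fin 2 =>
      ‖(List.ofFn fun i => ![linearPart A₀, linearPart A₁] (d i)).prod‖)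
      (Set.finite_range _).bddAbove (fun i => d (Fin.castAdd n i))
  · exact le_ciSup (f := fun d : Fin n → Fin 2 =>
      ‖(List.ofFn fun i => ![linearPart A₀, linearPart A₁] (d i)).prod‖)
      (Set.finite_range _).bddAbove (fun i => d (Fin.natAdd m i))

/-- The limit in the definition of the joint spectral radius exists. -/
theorem tendsto_jointSpectralRadius (A₀ A₁ : E →ᵃ[ℝ] E) :
    Tendsto (fun r : ℕ => maxProductNorm A₀ A₁ r ^ (1 / (r : ℝ))) atTop
      (𝓝 (jointSpectralRadius A₀ A₁)) := by
  refine tendsto_nhds_limUnder ?_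
  by_cases h : ∃ r, maxProductNorm A₀ A₁ r = 0
  · obtain ⟨r, hr⟩ := h
    refine ⟨0, tendsto_const_nhds.congr' ?_⟩
    filter_upwards [eventually_ge_atTop (r + 1)] with s hs
    obtain ⟨k, rfl⟩ := Nat.exists_eq_add_of_le (Nat.le_of_succ_le hs)
    have h0 : maxProductNorm A₀ A₁ (r + k) = 0 := by
      refine le_antisymm ?_ (maxProductNorm_nonneg _ _ _)
      simpa [hr] using maxProductNorm_add_le A₀ A₁ r k
    rw [h0, Real.zero_rpow]
    have : ((r + k : ℕ) : ℝ) ≠ 0 := by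
      have : r + k ≠ 0 := by omega
      exact_mod_cast this
    exact one_div_ne_zero this
  · push Not at h
    have hpos : ∀ r, 0 < maxProductNorm A₀ A₁ r := fun r =>
      lt_of_le_of_ne (maxProductNorm_nonneg _ _ _) (h r).symm
    have hsub : Subadditive fun r => Real.log (maxProductNorm A₀ A₁ r) := fun m n => by
      rw [← Real.log_mul (h m) (h n)]
      exact Real.log_le_log (hpos _) (maxProductNorm_add_le _ _ _ _)
    by_cases hb : BddBelow (Set.range fun n : ℕ => Real.log (maxProductNorm A₀ A₁ n) / n)
    · refine ⟨Real.exp hsub.lim, ((Real.continuous_exp.tendsto _).comp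
        (hsub.tendsto_lim hb)).congr fun n => ?_⟩
      rw [Function.comp_apply, Real.rpow_def_of_pos (hpos n), mul_one_div]
    · have hbot : Tendsto (fun n : ℕ => Real.log (maxProductNorm A₀ A₁ n) / n) atTop atBot := by
        refine tendsto_atBot.2 fun L => ?_
        obtain ⟨_, ⟨n, rfl⟩, hn⟩ := not_bddBelow_iff.1 hb (min L 0)
        have hn0 : n ≠ 0 := by
          rintro rfl
          simp at hn
        filter_upwards [hsub.eventually_div_lt_of_div_lt hn0 hn] with p hp
        exact (hp.trans_le (min_le_left _ _)).le
      refine ⟨0, (Real.tendsto_exp_atBot.comp hbot).congr fun n => ?_⟩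
      rw [Function.comp_apply, Real.rpow_def_of_pos (hpos n), mul_one_div]

end

end DyadicCurve

/-! Work with digit sequences in Cantor space. Digitwise subtraction has no carries, so `y ⊖ x`
measures, up to a factor, `2⁻ᵏ` with `k` the length of the common prefix. Both branches of the
equation shift the digits; iterating, `v t` is a composition along the first `n` digits of `t`
applied to the value at the shifted point. The sequences `0111…` and `1000…` are at distance 1, so
the two branches need not match at `1/2`: no cross condition arises.

If `ρ < γ`, linear products of length `n` are `O(γ ^ n)`. When `ρ < 1`, compositions therefore
converge along every digit sequence, to limits that differ by `O(γ ^ n)` on a common prefix of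
length `n` (`exists_norm_limitCurve_sub_le`). This gives existence and, with `γ = 2 ^ (-α)`, the
lower bound on the exponent. It reaches every `W`-continuous solution by uniqueness
(`IsSelfSimilar.eq_limitCurve`).

Conversely, a Hölder bound with exponent `α` makes every product of length `k` send each `v x - v
0`, `x < 1`, to a vector of norm `O(2 ^ (-α * k))`. Without a common invariant subspace these
vectors span the space, so the products themselves are `O(2 ^ (-α * k))` and `ρ ≤ 2 ^ (-α)`
(`holderExponent_le_negLogTwo`). -/

namespace DyadicCurve

noncomputable section

/-! ### Binary digits of the points of the segment -/

/-- The binary digits after the binary point of a point of `[0, 1]`. -/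
def unitDigits (x : ℝ) : ℕ → Fin 2 := if x = 1 then fun _ => 1 else Real.digits x 2

theorem unitDigits_one (n : ℕ) : unitDigits 1 n = 1 := by simp [unitDigits]

theorem unitDigits_of_ne {x : ℝ} (hx : x ≠ 1) : unitDigits x = Real.digits x 2 := by
  simp [unitDigits, hx]

theorem ofDigits_const_one : Real.ofDigits (fun _ => (1 : Fin 2)) = 1 :=
  Real.ofDigits_const_last_eq_one 1

theorem ofDigits_unitDigits {x : ℝ} (hx : x ∈ Set.Icc (0 : ℝ) 1) :
    Real.ofDigits (unitDigits x) = x := by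
  by_cases h : x = 1
  · subst h
    rw [show unitDigits 1 = fun _ => (1 : Fin 2) from funext unitDigits_one, ofDigits_const_one]
  · rw [unitDigits_of_ne h]
    exact Real.ofDigits_digits one_lt_two ⟨hx.1, lt_of_le_of_ne hx.2 h⟩

theorem ofDigits_eq_head_add_tail (d : ℕ → Fin 2) :
    Real.ofDigits d = ((d 0 : ℕ) + Real.ofDigits fun n => d (n + 1)) / 2 := by
  rw [Real.ofDigits_eq_sum_add_ofDigits d 1]
  simp [Real.ofDigitsTerm]
  ring

theorem two_pow_inv_le_ofDigits {d : ℕ → Fin 2} {n : ℕ} (h : d n ≠ 0) :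
    ((2 : ℝ) ^ (n + 1))⁻¹ ≤ Real.ofDigits d := by
  refine le_trans ?_ (Real.summable_ofDigitsTerm.le_tsum n fun _ _ => Real.ofDigitsTerm_nonneg)
  have : d n = 1 := by omega
  simp [Real.ofDigitsTerm, this]

theorem unitExpansion_neg {x : ℝ} (hx : x ∈ Set.Icc (0 : ℝ) 1) (n : ℕ) :
    unitExpansion x (-(n + 1 : ℤ)) = unitDigits x n := by
  by_cases h : x = 1
  · subst h
    rw [unitDigits_one, unitExpansion, if_pos rfl, if_pos (by omega)]
    rfl
  · rw [unitDigits_of_ne h, unitExpansion, if_neg h, expansion, neg_neg, Real.digits]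
    have h1 : (2 : ℝ) ^ ((n : ℤ) + 1) = 2 ^ (n + 1) := by exact_mod_cast zpow_natCast (2 : ℝ) (n + 1)
    rw [h1, ← Int.natCast_floor_eq_floor (mul_nonneg hx.1 (by positivity)), Int.cast_natCast]
    apply ZMod.val_injective
    rw [ZMod.val_natCast]
    simp [ZMod.val]

theorem unitExpansion_of_nonneg {x : ℝ} (hx : x ∈ Set.Icc (0 : ℝ) 1) {j : ℤ} (hj : 0 ≤ j) :
    unitExpansion x j = 0 := by
  by_cases h : x = 1
  · rw [unitExpansion, if_pos h, if_neg (by omega)]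
  · rw [unitExpansion, if_neg h, expansion]
    have : ⌊x * (2 : ℝ) ^ (-j)⌋ = 0 := by
      rw [Int.floor_eq_zero_iff]
      refine ⟨mul_nonneg hx.1 (by positivity), ?_⟩
      have h2 : (2 : ℝ) ^ (-j) ≤ 1 := zpow_le_one_of_nonpos₀ one_le_two (by omega)
      nlinarith [hx.1, lt_of_le_of_ne hx.2 h]
    rw [this, Int.cast_zero]

theorem expansion_one_zero : expansion 1 0 = 1 := by simp [expansion]

theorem expansion_one_neg (n : ℕ) : expansion 1 (-(n + 1 : ℤ)) = 0 := by
  rw [expansion, neg_neg, one_mul]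
  have h1 : (2 : ℝ) ^ ((n : ℤ) + 1) = ((2 ^ (n + 1) : ℤ) : ℝ) := by
    push_cast
    exact_mod_cast zpow_natCast (2 : ℝ) (n + 1)
  rw [h1, Int.floor_intCast]
  push_cast
  rw [show (2 : ZMod 2) = 0 from rfl]
  simp

theorem expansion_one_pos {j : ℤ} (hj : 0 < j) : expansion 1 j = 0 := by
  have : ⌊(1 : ℝ) * (2 : ℝ) ^ (-j)⌋ = 0 := by
    rw [Int.floor_eq_zero_iff, one_mul]
    exact ⟨by positivity, zpow_lt_one_of_neg₀ one_lt_two (by omega)⟩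
  rw [expansion, this, Int.cast_zero]

/-! ### Dyadic distance and common prefixes. -/

theorem value_eq_ofDigits {a : DigitSeq} {d : ℕ → Fin 2}
    (hneg : ∀ n : ℕ, a (-(n + 1 : ℤ)) = d n) (hpos : ∀ j : ℤ, 0 ≤ j → a j = 0) :
    value a = Real.ofDigits d := by
  have hinj : Function.Injective fun n : ℕ => -(n + 1 : ℤ) := fun m n h => by
    simpa using h
  rw [value, Real.ofDigits, ← hinj.tsum_eq]
  · refine tsum_congr fun n => ?_
    rw [hneg, Real.ofDigitsTerm, zpow_neg]
    have h1 : (2 : ℝ) ^ ((n : ℤ) + 1) = 2 ^ (n + 1) := by exact_mod_cast zpow_natCast (2 : ℝ) (n + 1)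
    rw [h1]
    rfl
  · intro j hj
    by_contra hr
    refine hj ?_
    have : 0 ≤ j := by
      by_contra hlt
      exact hr ⟨(-j - 1).toNat, by simp only; omega⟩
    simp [hpos j this]

theorem dyadicDist_eq {x y : ℝ} (hx : x ∈ Set.Icc (0 : ℝ) 1) (hy : y ∈ Set.Icc (0 : ℝ) 1) :
    dyadicDist x y = Real.ofDigits fun n => unitDigits x n - unitDigits y n := by
  refine value_eq_ofDigits (fun n => ?_) fun j hj => ?_
  · rw [Pi.sub_apply, unitExpansion_neg hx, unitExpansion_neg hy]
    rfl
  · rw [Pi.sub_apply, unitExpansion_of_nonneg hx hj, unitExpansion_of_nonneg hy hj, sub_zero]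

/-- All terms of the digitwise difference are nonnegative, so a single mismatch among the first `k`
digits already contributes at least `2⁻ᵏ`. -/
theorem unitDigits_eq_of_dyadicDist_lt {x y : ℝ} (hx : x ∈ Set.Icc (0 : ℝ) 1)
    (hy : y ∈ Set.Icc (0 : ℝ) 1) {k : ℕ} (h : dyadicDist x y < ((2 : ℝ) ^ k)⁻¹) :
    ∀ i < k, unitDigits x i = unitDigits y i := by
  intro i hi
  by_contra hne
  rw [dyadicDist_eq hx hy] at h
  have h1 := two_pow_inv_le_ofDigits (d := fun n => unitDigits x n - unitDigits y n) (n := i)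
    (sub_ne_zero.2 hne)
  have h2 : ((2 : ℝ) ^ k)⁻¹ ≤ ((2 : ℝ) ^ (i + 1))⁻¹ :=
    inv_anti₀ (by positivity) (pow_le_pow_right₀ one_le_two hi)
  linarith

/-- The inequality is not strict: a difference whose tail consists of ones attains the bound. -/
theorem dyadicDist_le {x y : ℝ} (hx : x ∈ Set.Icc (0 : ℝ) 1)
    (hy : y ∈ Set.Icc (0 : ℝ) 1) {k : ℕ} (h : ∀ i < k, unitDigits x i = unitDigits y i) :
    dyadicDist x y ≤ ((2 : ℝ) ^ k)⁻¹ := by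
  rw [dyadicDist_eq hx hy, Real.ofDigits_eq_sum_add_ofDigits _ k, Finset.sum_eq_zero, zero_add]
  · exact mul_le_of_le_one_right (by positivity) (Real.ofDigits_le_one _)
  · intro i hi
    simp [Real.ofDigitsTerm, h i (Finset.mem_range.1 hi)]

/-! ### The doubling map -/

/-- The shift of the binary digits of a point of `[0, 1]`. -/
def doubling (t : ℝ) : ℝ := if t < 1 / 2 then 2 * t else 2 * t - 1

theorem doubling_mem {t : ℝ} (ht : t ∈ Set.Icc (0 : ℝ) 1) : doubling t ∈ Set.Icc (0 : ℝ) 1 := by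
  obtain ⟨h0, h1⟩ := ht
  rw [doubling]
  split_ifs with h <;> constructor <;> linarith

theorem unitDigits_zero_of_lt {t : ℝ} (h : t < 1 / 2) : unitDigits t 0 = 0 := by
  rw [unitDigits_of_ne (by linarith), Real.digits]
  have : ⌊t * ((2 : ℕ) : ℝ) ^ (0 + 1)⌋₊ = 0 := by
    rw [Nat.floor_eq_zero]
    push_cast
    linarith
  rw [this]
  rfl

theorem unitDigits_zero_of_le {t : ℝ} (h : 1 / 2 ≤ t) (h1 : t ≤ 1) : unitDigits t 0 = 1 := by
  by_cases ht : t = 1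
  · rw [ht, unitDigits_one]
  · rw [unitDigits_of_ne ht, Real.digits]
    have : ⌊t * ((2 : ℕ) : ℝ) ^ (0 + 1)⌋₊ = 1 := by
      have := lt_of_le_of_ne h1 ht
      rw [Nat.floor_eq_iff (by push_cast; linarith)]
      push_cast
      constructor <;> linarith
    rw [this]
    rfl

theorem unitDigits_doubling {t : ℝ} (ht : t ∈ Set.Icc (0 : ℝ) 1) (n : ℕ) :
    unitDigits (doubling t) n = unitDigits t (n + 1) := by
  obtain ⟨h0, h1⟩ := ht
  rw [doubling]
  split_ifs with h
  · rw [unitDigits_of_ne (by linarith), unitDigits_of_ne (by linarith), Real.digits, Real.digits]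
    congr 2
    ring
  · by_cases ht : t = 1
    · subst ht
      norm_num [unitDigits_one]
    · have : 2 * t - 1 ≠ 1 := fun h => ht (by linarith)
      rw [unitDigits_of_ne ht, unitDigits_of_ne this, Real.digits, Real.digits]
      have h2 : (2 * t - 1) * ((2 : ℕ) : ℝ) ^ (n + 1) =
          t * ((2 : ℕ) : ℝ) ^ (n + 1 + 1) - ((2 ^ (n + 1) : ℕ) : ℝ) := by
        push_cast
        ring
      -- This keeps the natural subtraction from truncating; the subtracted power is even, so the
      -- parity of the floor is unchanged.
      have h3 : 2 ^ (n + 1) ≤ ⌊t * ((2 : ℕ) : ℝ) ^ (n + 1 + 1)⌋₊ := by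
        apply Nat.le_floor
        push_cast
        rw [pow_succ (2 : ℝ) (n + 1)]
        have : (0 : ℝ) < 2 ^ (n + 1) := by positivity
        nlinarith
      rw [h2, Nat.floor_sub_natCast]
      apply Fin.ext
      simp only [Fin.val_ofNat]
      have : 2 ^ (n + 1) = 2 * 2 ^ n := by ring
      omega

theorem doubleSubOne_eq {t : ℝ} (h : 1 / 2 ≤ t) (h1 : t ≤ 1) : doubleSubOne t = 2 * t - 1 := by
  have ht : t ∈ Set.Icc (0 : ℝ) 1 := ⟨by linarith, h1⟩
  have h2 : doubleSubOne t = Real.ofDigits fun n => unitDigits t (n + 1) := by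
    refine value_eq_ofDigits (fun n => ?_) fun j hj => ?_
    · rw [Pi.sub_apply, expansion_one_neg, sub_zero, double]
      have := unitExpansion_neg ht (n + 1)
      rw [← this, show -((n : ℤ) + 1) - 1 = -((n + 1 : ℕ) + 1 : ℤ) by push_cast; ring]
    · rw [Pi.sub_apply, double]
      -- At position 0 the leading digit 1 of `t`, moved there by doubling, cancels the only digit
      -- of `expansion 1`.
      obtain rfl | hj := hj.eq_or_lt
      · have := unitExpansion_neg ht 0
        rw [unitDigits_zero_of_le h h1] at this
        rw [expansion_one_zero]
        exact sub_eq_zero.2 this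
      · rw [expansion_one_pos hj, unitExpansion_of_nonneg ht (by omega), sub_zero]
  have h3 := ofDigits_eq_head_add_tail (unitDigits t)
  rw [ofDigits_unitDigits ht, unitDigits_zero_of_le h h1, ← h2] at h3
  simp at h3
  linarith

theorem doubling_iterate_mem {t : ℝ} (ht : t ∈ Set.Icc (0 : ℝ) 1) (n : ℕ) :
    doubling^[n] t ∈ Set.Icc (0 : ℝ) 1 := by
  induction n with
  | zero => exact ht
  | succ n ih =>
    rw [Function.iterate_succ_apply']
    exact doubling_mem ih

theorem unitDigits_doubling_iterate {t : ℝ} (ht : t ∈ Set.Icc (0 : ℝ) 1) (n m : ℕ) :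
    unitDigits (doubling^[n] t) m = unitDigits t (m + n) := by
  induction n generalizing m with
  | zero => rfl
  | succ n ih =>
    rw [Function.iterate_succ_apply', unitDigits_doubling (doubling_iterate_mem ht n), ih]
    congr 1
    ring

theorem ofDigits_lt_one {d : ℕ → Fin 2} {n : ℕ} (h : d n = 0) : Real.ofDigits d < 1 := by
  induction n generalizing d with
  | zero =>
    rw [ofDigits_eq_head_add_tail, h]
    have := Real.ofDigits_le_one fun n => d (n + 1)
    simp
    linarith
  | succ n ih =>
    have := ih (d := fun n => d (n + 1)) h
    rw [ofDigits_eq_head_add_tail]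
    have h1 : ((d 0 : ℕ) : ℝ) ≤ 1 := by exact_mod_cast Nat.lt_succ_iff.1 (d 0).isLt
    linarith

/-- A sequence with infinitely many zeros is the sequence of digits of the number it represents. -/
theorem unitDigits_ofDigits {d : ℕ → Fin 2} (h : ∀ n, ∃ m, n ≤ m ∧ d m = 0) :
    unitDigits (Real.ofDigits d) = d := by
  funext n
  induction n generalizing d with
  | zero =>
    obtain ⟨m, hm, hd⟩ := h 1
    have h1 : Real.ofDigits (fun n => d (n + 1)) < 1 :=
      ofDigits_lt_one (n := m - 1) (by simpa [Nat.sub_add_cancel hm] using hd)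
    have h2 := Real.ofDigits_nonneg fun n => d (n + 1)
    rw [ofDigits_eq_head_add_tail]
    obtain hd | hd : d 0 = 0 ∨ d 0 = 1 := by omega
    · rw [hd]
      simp only [Fin.val_zero, Nat.cast_zero]
      exact unitDigits_zero_of_lt (by linarith)
    · rw [hd]
      simp only [Fin.val_one, Nat.cast_one]
      exact unitDigits_zero_of_le (by linarith) (by linarith)
  | succ n ih =>
    have hd : doubling (Real.ofDigits d) = Real.ofDigits fun n => d (n + 1) := by
      obtain ⟨m, hm, hd⟩ := h 1
      have h1 : Real.ofDigits (fun n => d (n + 1)) < 1 :=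
        ofDigits_lt_one (n := m - 1) (by simpa [Nat.sub_add_cancel hm] using hd)
      have h2 := Real.ofDigits_nonneg fun n => d (n + 1)
      rw [ofDigits_eq_head_add_tail, doubling]
      obtain hd | hd : d 0 = 0 ∨ d 0 = 1 := by omega
      · rw [hd, if_pos (by simp; linarith)]
        simp
        ring
      · rw [hd, if_neg (by simp; linarith)]
        simp
        ring
    rw [← unitDigits_doubling ⟨Real.ofDigits_nonneg d, Real.ofDigits_le_one d⟩, hd]
    refine ih (d := fun n => d (n + 1)) fun k => ?_
    obtain ⟨m, hm, hd⟩ := h (k + 1)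
    exact ⟨m - 1, by omega, by simpa [Nat.sub_add_cancel (show 1 ≤ m by omega)] using hd⟩

/-! ### Products along words -/

section Words

variable {E : Type*} [NormedAddCommGroup E] [NormedSpace ℝ E]

/-- The composition `A_{d₀} ∘ ⋯ ∘ A_{d_{n-1}}` applied to a point. -/
def applyWord (A₀ A₁ : E →ᵃ[ℝ] E) : ℕ → (ℕ → Fin 2) → E → E
  | 0, _, x => x
  | n + 1, d, x => ![A₀, A₁] (d 0) (applyWord A₀ A₁ n (fun i => d (i + 1)) x)

theorem applyWord_add (A₀ A₁ : E →ᵃ[ℝ] E) (n m : ℕ) (d : ℕ → Fin 2) (x : E) :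
    applyWord A₀ A₁ (n + m) d x =
      applyWord A₀ A₁ n d (applyWord A₀ A₁ m (fun i => d (i + n)) x) := by
  induction n generalizing d with
  | zero => simp [applyWord]
  | succ n ih =>
    rw [Nat.succ_add, applyWord, applyWord, ih]
    grind

theorem applyWord_congr (A₀ A₁ : E →ᵃ[ℝ] E) {n : ℕ} {d e : ℕ → Fin 2}
    (h : ∀ i < n, d i = e i) (x : E) : applyWord A₀ A₁ n d x = applyWord A₀ A₁ n e x := by
  induction n generalizing d e with
  | zero => rfl
  | succ n ih =>
    rw [applyWord, applyWord, h 0 (Nat.succ_pos n), ih fun i hi => h (i + 1) (by omega)]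

theorem applyWord_unitDigits {A₀ A₁ : E →ᵃ[ℝ] E} {v : ℝ → E} (hv : IsSelfSimilar A₀ A₁ v)
    {t : ℝ} (ht : t ∈ Set.Icc (0 : ℝ) 1) (n : ℕ) :
    v t = applyWord A₀ A₁ n (unitDigits t) (v (doubling^[n] t)) := by
  induction n generalizing t with
  | zero => rfl
  | succ n ih =>
    have h1 := ih (doubling_mem ht)
    rw [applyWord, Function.iterate_succ_apply]
    simp only [← unitDigits_doubling ht]
    rw [← h1]
    by_cases h : t < 1 / 2
    · rw [unitDigits_zero_of_lt h, doubling, if_pos h, hv.1 t ⟨ht.1, h⟩]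
      rfl
    · have h' := not_lt.1 h
      rw [unitDigits_zero_of_le h' ht.2, doubling, if_neg h, hv.2 t ⟨h', ht.2⟩,
        doubleSubOne_eq h' ht.2]
      rfl

variable [FiniteDimensional ℝ E]

/-- The linear part of the composition along a word. -/
def wordLinear (A₀ A₁ : E →ᵃ[ℝ] E) (n : ℕ) (d : ℕ → Fin 2) : E →L[ℝ] E :=
  (List.ofFn fun i : Fin n => ![linearPart A₀, linearPart A₁] (d i)).prod

theorem wordLinear_succ (A₀ A₁ : E →ᵃ[ℝ] E) (n : ℕ) (d : ℕ → Fin 2) :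
    wordLinear A₀ A₁ (n + 1) d =
      ![linearPart A₀, linearPart A₁] (d 0) * wordLinear A₀ A₁ n fun i => d (i + 1) := by
  simp [wordLinear, List.ofFn_succ]

theorem norm_wordLinear_le (A₀ A₁ : E →ᵃ[ℝ] E) (n : ℕ) (d : ℕ → Fin 2) :
    ‖wordLinear A₀ A₁ n d‖ ≤ maxProductNorm A₀ A₁ n :=
  le_ciSup (f := fun d : Fin n → Fin 2 =>
    ‖(List.ofFn fun i => ![linearPart A₀, linearPart A₁] (d i)).prod‖)
    (Set.finite_range _).bddAbove fun i => d i

theorem maxProductNorm_le {A₀ A₁ : E →ᵃ[ℝ] E} {n : ℕ} {K : ℝ}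
    (h : ∀ d, ‖wordLinear A₀ A₁ n d‖ ≤ K) : maxProductNorm A₀ A₁ n ≤ K := by
  refine ciSup_le fun d => ?_
  have := h fun i => if hi : i < n then d ⟨i, hi⟩ else 0
  simpa [wordLinear] using this

theorem affine_pick_sub (A₀ A₁ : E →ᵃ[ℝ] E) (i : Fin 2) (x y : E) :
    ![A₀, A₁] i x - ![A₀, A₁] i y = ![linearPart A₀, linearPart A₁] i (x - y) := by
  fin_cases i
  · exact (A₀.linearMap_vsub x y).symm
  · exact (A₁.linearMap_vsub x y).symm

/-- Translations cancel in differences, so only the linear parts matter for contraction. -/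
theorem applyWord_sub (A₀ A₁ : E →ᵃ[ℝ] E) (n : ℕ) (d : ℕ → Fin 2) (x y : E) :
    applyWord A₀ A₁ n d x - applyWord A₀ A₁ n d y = wordLinear A₀ A₁ n d (x - y) := by
  induction n generalizing d with
  | zero => simp [applyWord, wordLinear]
  | succ n ih =>
    rw [applyWord, applyWord, affine_pick_sub, ih, wordLinear_succ]
    rfl

theorem continuous_affine_pick (A₀ A₁ : E →ᵃ[ℝ] E) (i : Fin 2) :
    Continuous (![A₀, A₁] i) := AffineMap.continuous_of_finiteDimensional _

/-! ### Joint spectral radius and geometric growth of products. -/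

theorem jointSpectralRadius_nonneg (A₀ A₁ : E →ᵃ[ℝ] E) : 0 ≤ jointSpectralRadius A₀ A₁ :=
  ge_of_tendsto' (tendsto_jointSpectralRadius A₀ A₁) fun _ =>
    Real.rpow_nonneg (maxProductNorm_nonneg _ _ _) _

theorem exists_maxProductNorm_le_mul_pow {A₀ A₁ : E →ᵃ[ℝ] E} {γ : ℝ}
    (h : jointSpectralRadius A₀ A₁ < γ) :
    ∃ C, 0 ≤ C ∧ ∀ n, maxProductNorm A₀ A₁ n ≤ C * γ ^ n := by
  have hγ : 0 < γ := (jointSpectralRadius_nonneg A₀ A₁).trans_lt h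
  obtain ⟨n₀, hn₀⟩ := eventually_atTop.1
    ((tendsto_jointSpectralRadius A₀ A₁).eventually (gt_mem_nhds h))
  have hterm (n : ℕ) : 0 ≤ maxProductNorm A₀ A₁ n / γ ^ n :=
    div_nonneg (maxProductNorm_nonneg _ _ _) (by positivity)
  -- The sum absorbs the finitely many initial lengths; the summand 1 serves all later ones. Summing
  -- up to `n₀` inclusive ensures `n ≠ 0` there.
  refine ⟨1 + ∑ n ∈ Finset.range (n₀ + 1), maxProductNorm A₀ A₁ n / γ ^ n,
    add_nonneg zero_le_one (Finset.sum_nonneg fun n _ => hterm n), fun n => ?_⟩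
  rw [← div_le_iff₀ (by positivity)]
  by_cases hn : n < n₀ + 1
  · have := Finset.single_le_sum (f := fun n => maxProductNorm A₀ A₁ n / γ ^ n)
      (fun n _ => hterm n) (Finset.mem_range.2 hn)
    linarith
  · have h1 : maxProductNorm A₀ A₁ n / γ ^ n ≤ 1 := by
      rw [div_le_one (by positivity)]
      have h2 := (hn₀ n (by omega)).le
      have hn0 : (n : ℝ) ≠ 0 := by
        have : n ≠ 0 := by omega
        exact_mod_cast this
      calc maxProductNorm A₀ A₁ n = (maxProductNorm A₀ A₁ n ^ (1 / (n : ℝ))) ^ n := by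
            rw [← Real.rpow_natCast, ← Real.rpow_mul (maxProductNorm_nonneg _ _ _),
              one_div_mul_cancel hn0, Real.rpow_one]
        _ ≤ γ ^ n := pow_le_pow_left₀ (Real.rpow_nonneg (maxProductNorm_nonneg _ _ _) _) h2 n
    have := Finset.sum_nonneg fun n (_ : n ∈ Finset.range (n₀ + 1)) => hterm n
    linarith

theorem jointSpectralRadius_le_of_maxProductNorm_le {A₀ A₁ : E →ᵃ[ℝ] E} {γ K : ℝ} (hγ : 0 ≤ γ)
    (h : ∀ n, maxProductNorm A₀ A₁ n ≤ K * γ ^ n) : jointSpectralRadius A₀ A₁ ≤ γ := by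
  -- A positive constant is needed for `K' ^ (1 / n) → 1`.
  set K' := max K 1
  have hK' : 0 < K' := lt_max_of_lt_right one_pos
  have h1 : Tendsto (fun n : ℕ => K' ^ (1 / (n : ℝ)) * γ) atTop (𝓝 γ) := by
    have h2 : Tendsto (fun n : ℕ => K' ^ (1 / (n : ℝ))) atTop (𝓝 (K' ^ (0 : ℝ))) :=
      tendsto_const_nhds.rpow tendsto_one_div_atTop_nhds_zero_nat (Or.inl hK'.ne')
    simpa using h2.mul_const γ
  refine le_of_tendsto_of_tendsto (tendsto_jointSpectralRadius A₀ A₁) h1 ?_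
  filter_upwards [eventually_ne_atTop 0] with n hn
  have hn0 : (n : ℝ) ≠ 0 := by exact_mod_cast hn
  have h3 : maxProductNorm A₀ A₁ n ≤ K' * γ ^ n :=
    (h n).trans (mul_le_mul_of_nonneg_right (le_max_left _ _) (by positivity))
  calc maxProductNorm A₀ A₁ n ^ (1 / (n : ℝ)) ≤ (K' * γ ^ n) ^ (1 / (n : ℝ)) :=
        Real.rpow_le_rpow (maxProductNorm_nonneg _ _ _) h3 (by positivity)
    _ = K' ^ (1 / (n : ℝ)) * γ := by
        rw [Real.mul_rpow hK'.le (by positivity), ← Real.rpow_natCast, ← Real.rpow_mul hγ,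
          mul_one_div_cancel hn0, Real.rpow_one]

/-! ### The limit curve -/

/-- The limit of the compositions along a sequence of digits. -/
def limitCurve (A₀ A₁ : E →ᵃ[ℝ] E) (d : ℕ → Fin 2) : E :=
  limUnder atTop fun n => applyWord A₀ A₁ n d 0

theorem exists_dist_applyWord_succ_le {A₀ A₁ : E →ᵃ[ℝ] E} {γ : ℝ}
    (h : jointSpectralRadius A₀ A₁ < γ) :
    ∃ C, ∀ d n, dist (applyWord A₀ A₁ n d 0) (applyWord A₀ A₁ (n + 1) d 0) ≤ C * γ ^ n := by
  obtain ⟨C, hC, hCn⟩ := exists_maxProductNorm_le_mul_pow h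
  refine ⟨C * (‖A₀ 0‖ + ‖A₁ 0‖), fun d n => ?_⟩
  have h1 : ‖![A₀, A₁] (d n) 0‖ ≤ ‖A₀ 0‖ + ‖A₁ 0‖ := by
    generalize d n = i
    fin_cases i <;> simp
  rw [dist_comm, dist_eq_norm, applyWord_add, applyWord_sub]
  simp only [applyWord, sub_zero, zero_add]
  calc _ ≤ ‖wordLinear A₀ A₁ n d‖ * ‖![A₀, A₁] (d n) 0‖ := ContinuousLinearMap.le_opNorm _ _
    _ ≤ (C * γ ^ n) * (‖A₀ 0‖ + ‖A₁ 0‖) :=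
        mul_le_mul ((norm_wordLinear_le _ _ _ _).trans (hCn n)) h1 (norm_nonneg _)
          ((maxProductNorm_nonneg _ _ _).trans (hCn n))
    _ = _ := by ring

variable {A₀ A₁ : E →ᵃ[ℝ] E}

theorem tendsto_limitCurve (h : jointSpectralRadius A₀ A₁ < 1) (d : ℕ → Fin 2) :
    Tendsto (fun n => applyWord A₀ A₁ n d 0) atTop (𝓝 (limitCurve A₀ A₁ d)) := by
  obtain ⟨γ, h1, h2⟩ := exists_between h
  obtain ⟨C, hC⟩ := exists_dist_applyWord_succ_le h1
  exact (cauchySeq_of_le_geometric γ C h2 (hC d)).tendsto_limUnder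

theorem exists_norm_limitCurve_le (h : jointSpectralRadius A₀ A₁ < 1) :
    ∃ B, ∀ d, ‖limitCurve A₀ A₁ d‖ ≤ B := by
  obtain ⟨γ, h1, h2⟩ := exists_between h
  obtain ⟨C, hC⟩ := exists_dist_applyWord_succ_le h1
  refine ⟨C / (1 - γ), fun d => ?_⟩
  have := dist_le_of_le_geometric_of_tendsto₀ γ C h2 (hC d) (tendsto_limitCurve h d)
  simpa [applyWord] using this

theorem limitCurve_eq_head (h : jointSpectralRadius A₀ A₁ < 1) (d : ℕ → Fin 2) :
    limitCurve A₀ A₁ d = ![A₀, A₁] (d 0) (limitCurve A₀ A₁ fun i => d (i + 1)) :=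
  tendsto_nhds_unique ((tendsto_limitCurve h d).comp (tendsto_add_atTop_nat 1))
    (((continuous_affine_pick A₀ A₁ (d 0)).tendsto _).comp
      (tendsto_limitCurve h fun i => d (i + 1)))

theorem exists_norm_limitCurve_sub_le (h : jointSpectralRadius A₀ A₁ < 1) {γ : ℝ}
    (hγ : jointSpectralRadius A₀ A₁ < γ) :
    ∃ C, 0 ≤ C ∧ ∀ (n : ℕ) (d e : ℕ → Fin 2), (∀ i < n, d i = e i) →
      ‖limitCurve A₀ A₁ d - limitCurve A₀ A₁ e‖ ≤ C * γ ^ n := by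
  obtain ⟨C, hC, hCn⟩ := exists_maxProductNorm_le_mul_pow hγ
  obtain ⟨B, hB⟩ := exists_norm_limitCurve_le h
  have hB0 : 0 ≤ B := (norm_nonneg _).trans (hB 0)
  have hword (n : ℕ) (d : ℕ → Fin 2) : limitCurve A₀ A₁ d =
      applyWord A₀ A₁ n d (limitCurve A₀ A₁ fun i => d (i + n)) := by
    induction n generalizing d with
    | zero => rfl
    | succ n ih =>
      rw [limitCurve_eq_head h, ih, applyWord]
      congr 4
  refine ⟨C * (B + B), by positivity, fun n d e hde => ?_⟩
  rw [hword n d, hword n e, applyWord_congr A₀ A₁ hde, applyWord_sub]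
  calc _ ≤ ‖wordLinear A₀ A₁ n e‖ * _ := ContinuousLinearMap.le_opNorm _ _
    _ ≤ (C * γ ^ n) * (B + B) :=
        mul_le_mul ((norm_wordLinear_le _ _ _ _).trans (hCn n))
          ((norm_sub_le _ _).trans (add_le_add (hB _) (hB _))) (norm_nonneg _)
          ((maxProductNorm_nonneg _ _ _).trans (hCn n))
    _ = _ := by ring

theorem isSelfSimilar_limitCurve (h : jointSpectralRadius A₀ A₁ < 1) :
    IsSelfSimilar A₀ A₁ fun t => limitCurve A₀ A₁ (unitDigits t) := by
  constructor
  · intro t ht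
    have ht' : t ∈ Set.Icc (0 : ℝ) 1 := ⟨ht.1, by linarith [ht.2]⟩
    have h1 : (fun i => unitDigits t (i + 1)) = unitDigits (2 * t) := by
      funext i
      rw [← unitDigits_doubling ht', doubling, if_pos ht.2]
    simp only
    rw [limitCurve_eq_head h, unitDigits_zero_of_lt ht.2, h1]
    rfl
  · intro t ht
    have ht' : t ∈ Set.Icc (0 : ℝ) 1 := ⟨by linarith [ht.1], ht.2⟩
    have h1 : (fun i => unitDigits t (i + 1)) = unitDigits (2 * t - 1) := by
      funext i
      rw [← unitDigits_doubling ht', doubling, if_neg (not_lt.2 ht.1)]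
    simp only
    rw [limitCurve_eq_head h, unitDigits_zero_of_le ht.1 ht.2, h1, doubleSubOne_eq ht.1 ht.2]
    rfl

theorem wContinuous_limitCurve (h : jointSpectralRadius A₀ A₁ < 1) :
    WContinuous fun t => limitCurve A₀ A₁ (unitDigits t) := by
  intro x hx ε hε
  obtain ⟨γ, h1, h2⟩ := exists_between h
  obtain ⟨C, -, hC⟩ := exists_norm_limitCurve_sub_le h h1
  have hlim : Tendsto (fun n : ℕ => C * γ ^ n) atTop (𝓝 0) := by
    simpa using (tendsto_pow_atTop_nhds_zero_of_lt_one
      ((jointSpectralRadius_nonneg A₀ A₁).trans h1.le) h2).const_mul C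
  obtain ⟨k, hk⟩ := (hlim.eventually (gt_mem_nhds hε)).exists
  exact ⟨((2 : ℝ) ^ k)⁻¹, by positivity, fun y hy hyx =>
    (hC k _ _ (unitDigits_eq_of_dyadicDist_lt hy hx hyx)).trans_lt hk⟩

end Words

section Uniqueness

variable {E : Type*} [NormedAddCommGroup E]

/-! ### Uniqueness of the continuous solution -/

/-- The orbit of a point under the doubling map accumulates, in the dyadic sense, at a point of
the segment. -/
theorem exists_frequently_unitDigits_eq {t : ℝ} (ht : t ∈ Set.Icc (0 : ℝ) 1) :
    ∃ x ∈ Set.Icc (0 : ℝ) 1, ∀ k : ℕ, ∃ᶠ n in atTop,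
      ∀ i < k, unitDigits (doubling^[n] t) i = unitDigits x i := by
  -- Cantor space is compact, but a cluster sequence `p` may end in ones and then need not be the
  -- expansion of a point.
  obtain ⟨p, hp⟩ := exists_clusterPt_of_compactSpace
    (map (fun n : ℕ => unitDigits (doubling^[n] t)) atTop)
  have hfreq (k : ℕ) : ∃ᶠ n in atTop, ∀ i < k, unitDigits (doubling^[n] t) i = p i := by
    have hopen : IsOpen {q : ℕ → Fin 2 | ∀ i < k, q i = p i} := by
      have : {q : ℕ → Fin 2 | ∀ i < k, q i = p i} =
          ⋂ i ∈ Set.Iio k, (fun q : ℕ → Fin 2 => q i) ⁻¹' {p i} := by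
        ext q
        simp
      rw [this]
      exact (Set.finite_Iio k).isOpen_biInter fun i _ =>
        (isOpen_discrete _).preimage (continuous_apply i)
    exact mapClusterPt_iff_frequently.1 hp _ (hopen.mem_nhds fun i _ => rfl)
  by_cases h : ∀ n, ∃ m, n ≤ m ∧ p m = 0
  · refine ⟨Real.ofDigits p, ⟨Real.ofDigits_nonneg p, Real.ofDigits_le_one p⟩, ?_⟩
    rwa [unitDigits_ofDigits h]
  · push Not at h
    obtain ⟨m, hm⟩ := h
    -- If `p` is 1 from index `m` on, following the orbit `m` steps further exposes long runs of
    -- ones, which are prefixes of the expansion of the point 1.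
    refine ⟨1, ⟨zero_le_one, le_rfl⟩, fun k => frequently_atTop.2 fun a => ?_⟩
    obtain ⟨b, hb, hbk⟩ := frequently_atTop.1 (hfreq (k + m)) a
    refine ⟨b + m, by omega, fun i hi => ?_⟩
    have h1 := hbk (i + m) (by omega)
    have h2 := hm (i + m) (by omega)
    rw [unitDigits_doubling_iterate ht] at h1 ⊢
    rw [unitDigits_one, show i + (b + m) = i + m + b by ring, h1]
    omega

/-- A `W`-continuous function may be unbounded (for instance as `t` increases to `1/2`), but
continuity at an accumulation point of the orbit bounds it infinitely often, which suffices for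
uniqueness. -/
theorem WContinuous.exists_frequently_norm_le {v : ℝ → E} (hv : WContinuous v) {t : ℝ}
    (ht : t ∈ Set.Icc (0 : ℝ) 1) : ∃ K, ∃ᶠ n in atTop, ‖v (doubling^[n] t)‖ ≤ K := by
  obtain ⟨x, hx, hfreq⟩ := exists_frequently_unitDigits_eq ht
  obtain ⟨δ, hδ, hvδ⟩ := hv x hx 1 one_pos
  obtain ⟨k, hk⟩ := exists_pow_lt_of_lt_one hδ (show (2⁻¹ : ℝ) < 1 by norm_num)
  refine ⟨1 + ‖v x‖, (hfreq k).mono fun n hn => ?_⟩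
  have hmem := doubling_iterate_mem ht n
  have h1 := hvδ _ hmem ((dyadicDist_le hmem hx hn).trans_lt (by rwa [← inv_pow]))
  have := norm_le_norm_sub_add (v (doubling^[n] t)) (v x)
  linarith

variable [NormedSpace ℝ E] [FiniteDimensional ℝ E] {A₀ A₁ : E →ᵃ[ℝ] E}

/-- Both solutions unfold along the same word, so their difference at `t` is a product of length `n`
applied to their difference at the `n`-th doubling; the latter is bounded for infinitely many `n`,
while the product decays. -/
theorem IsSelfSimilar.eq_limitCurve {v : ℝ → E} (h : jointSpectralRadius A₀ A₁ < 1)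
    (hs : IsSelfSimilar A₀ A₁ v) (hv : WContinuous v) {t : ℝ} (ht : t ∈ Set.Icc (0 : ℝ) 1) :
    v t = limitCurve A₀ A₁ (unitDigits t) := by
  by_contra hne
  obtain ⟨γ, h1, h2⟩ := exists_between h
  obtain ⟨C, -, hC⟩ := exists_maxProductNorm_le_mul_pow h1
  obtain ⟨B, hB⟩ := exists_norm_limitCurve_le h
  obtain ⟨K, hK⟩ := hv.exists_frequently_norm_le ht
  have hlim : Tendsto (fun n : ℕ => C * γ ^ n * (K + B)) atTop (𝓝 0) := by
    simpa using ((tendsto_pow_atTop_nhds_zero_of_lt_one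
      ((jointSpectralRadius_nonneg A₀ A₁).trans h1.le) h2).const_mul C).mul_const (K + B)
  obtain ⟨n, hn, hlt⟩ := (hK.and_eventually
    (hlim.eventually (gt_mem_nhds (norm_pos_iff.2 (sub_ne_zero.2 hne))))).exists
  refine absurd hlt (not_lt.2 ?_)
  have h3 := applyWord_unitDigits (isSelfSimilar_limitCurve h) ht n
  rw [h3, applyWord_unitDigits hs ht n, applyWord_sub]
  calc _ ≤ ‖wordLinear A₀ A₁ n (unitDigits t)‖ * _ := ContinuousLinearMap.le_opNorm _ _
    _ ≤ C * γ ^ n * (K + B) :=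
        mul_le_mul ((norm_wordLinear_le _ _ _ _).trans (hC n))
          ((norm_sub_le _ _).trans (add_le_add hn (hB _))) (norm_nonneg _)
          ((maxProductNorm_nonneg _ _ _).trans (hC n))

end Uniqueness

/-! ### The Hölder exponent -/

theorem lt_two_rpow_neg_of_lt_negLogTwo {ρ α : ℝ} (hρ : 0 ≤ ρ) (h : (α : EReal) < negLogTwo ρ) :
    ρ < 2 ^ (-α) := by
  obtain rfl | hρ := hρ.eq_or_lt
  · positivity
  · rw [negLogTwo, if_neg hρ.ne', EReal.coe_lt_coe_iff] at h
    rw [← Real.logb_lt_iff_lt_rpow one_lt_two hρ]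
    linarith

theorem le_negLogTwo_of_le_two_rpow_neg {ρ α : ℝ} (hρ : 0 ≤ ρ) (h : ρ ≤ 2 ^ (-α)) :
    (α : EReal) ≤ negLogTwo ρ := by
  obtain rfl | hρ := hρ.eq_or_lt
  · simp [negLogTwo]
  · rw [negLogTwo, if_neg hρ.ne', EReal.coe_le_coe_iff]
    rw [← Real.logb_le_iff_le_rpow one_lt_two hρ] at h
    linarith

theorem two_rpow_neg_pow (α : ℝ) (k : ℕ) :
    ((2 : ℝ) ^ (-α)) ^ k = ((2⁻¹ : ℝ) ^ k) ^ α := by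
  rw [← Real.rpow_natCast, ← Real.rpow_natCast, ← Real.rpow_mul two_pos.le,
    ← Real.rpow_mul (by norm_num), Real.inv_rpow two_pos.le, ← Real.rpow_neg two_pos.le]
  congr 1
  ring

/-- The point 1 must be excluded: a prefix containing a zero, followed by ones only, is not an
admissible expansion. -/
theorem exists_unitDigits_prefix (k : ℕ) (d : ℕ → Fin 2) {x : ℝ} (hx : x ∈ Set.Ico (0 : ℝ) 1) :
    ∃ y ∈ Set.Ico (0 : ℝ) 1, (∀ i < k, unitDigits y i = d i) ∧ doubling^[k] y = x := by
  induction k generalizing d with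
  | zero => exact ⟨x, hx, by simp, rfl⟩
  | succ k ih =>
    obtain ⟨y, ⟨hy0, hy1⟩, hyd, hyx⟩ := ih fun i => d (i + 1)
    suffices H : ∃ z ∈ Set.Ico (0 : ℝ) 1, unitDigits z 0 = d 0 ∧ doubling z = y by
      obtain ⟨z, hz, hz0, hzy⟩ := H
      refine ⟨z, hz, fun i hi => ?_, by rw [Function.iterate_succ_apply, hzy, hyx]⟩
      cases i with
      | zero => exact hz0
      | succ i =>
        rw [← unitDigits_doubling (Set.Ico_subset_Icc_self hz), hzy]
        exact hyd i (by omega)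
    obtain hd | hd : d 0 = 0 ∨ d 0 = 1 := by omega
    · refine ⟨y / 2, ⟨by linarith, by linarith⟩, ?_, ?_⟩
      · rw [hd, unitDigits_zero_of_lt (by linarith)]
      · rw [doubling, if_pos (by linarith)]
        ring
    · refine ⟨(1 + y) / 2, ⟨by linarith, by linarith⟩, ?_, ?_⟩
      · rw [hd, unitDigits_zero_of_le (by linarith) (by linarith)]
      · rw [doubling, if_neg (by linarith)]
        ring

section Exponent

variable {E : Type*} [NormedAddCommGroup E] {v : ℝ → E}

theorem dyadicModulus_le_of_digits {α C : ℝ} (hα : 0 < α) (hC : 0 ≤ C)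
    (h : ∀ x ∈ Set.Icc (0 : ℝ) 1, ∀ y ∈ Set.Icc (0 : ℝ) 1, ∀ k : ℕ,
      (∀ i < k, unitDigits x i = unitDigits y i) → ‖v x - v y‖ ≤ C * ((2 : ℝ) ^ (-α)) ^ k)
    {δ : ℝ} (hδ : 0 < δ) : dyadicModulus v δ ≤ ENNReal.ofReal (C * 2 ^ α * δ ^ α) := by
  refine iSup₂_le fun x hx => iSup₂_le fun y hy => iSup_le fun hyx => ?_
  rw [← ofReal_norm]
  refine ENNReal.ofReal_le_ofReal ?_
  rw [mul_assoc, ← Real.mul_rpow two_pos.le hδ.le]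
  by_cases h1 : δ ≤ 1
  · obtain ⟨k, hk1, hk2⟩ := exists_nat_pow_near_of_lt_one hδ h1
      (show (0 : ℝ) < 2⁻¹ by norm_num) (by norm_num)
    refine (h y hy x hx k (unitDigits_eq_of_dyadicDist_lt hy hx ?_)).trans ?_
    · rw [← inv_pow]
      exact hyx.trans_le hk2
    · rw [two_rpow_neg_pow]
      refine mul_le_mul_of_nonneg_left (Real.rpow_le_rpow (by positivity) ?_ hα.le) hC
      rw [pow_succ] at hk1
      linarith
  · refine (h y hy x hx 0 (by simp)).trans ?_
    rw [pow_zero]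
    exact mul_le_mul_of_nonneg_left (Real.one_le_rpow (by linarith) hα.le) hC

theorem exists_norm_sub_le_of_dyadicModulus_le {α C : ℝ}
    (h : ∀ δ : ℝ, 0 < δ → dyadicModulus v δ ≤ ENNReal.ofReal (C * δ ^ α)) :
    ∃ C', ∀ x ∈ Set.Icc (0 : ℝ) 1, ∀ y ∈ Set.Icc (0 : ℝ) 1, ∀ k : ℕ,
      (∀ i < k, unitDigits x i = unitDigits y i) → ‖v x - v y‖ ≤ C' * ((2 : ℝ) ^ (-α)) ^ k := by
  refine ⟨|C| * 2 ^ α, fun x hx y hy k hxy => ?_⟩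
  -- The modulus asks for distance strictly below `δ`, while a common prefix only gives `≤ 2⁻ᵏ`;
  -- hence the doubled scale.
  have hδ : (0 : ℝ) < 2 * 2⁻¹ ^ k := by positivity
  have hlt : dyadicDist x y < 2 * 2⁻¹ ^ k := by
    have h1 := dyadicDist_le hx hy hxy
    rw [← inv_pow] at h1
    linarith
  have h1 : ‖v x - v y‖ₑ ≤ dyadicModulus v (2 * 2⁻¹ ^ k) :=
    le_iSup₂_of_le y hy (le_iSup₂_of_le x hx (le_iSup_of_le hlt le_rfl))
  rw [two_rpow_neg_pow, mul_assoc, ← Real.mul_rpow two_pos.le (by positivity)]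
  refine (ENNReal.ofReal_le_ofReal_iff (by positivity)).1 ?_
  rw [ofReal_norm]
  exact h1.trans ((h _ hδ).trans (ENNReal.ofReal_le_ofReal
    (mul_le_mul_of_nonneg_right (le_abs_self C) (by positivity))))

variable [NormedSpace ℝ E] {A₀ A₁ : E →ᵃ[ℝ] E}

/-- The equation read backwards maps the values on `[0, 1)` into themselves: `A₀ (v x) = v (x / 2)`
and `A₁ (v x) = v ((1 + x) / 2)`. The first identity can fail at `x = 1`, hence the half-open
interval. -/
theorem IsSelfSimilar.affineSpan_eq_top (hs : IsSelfSimilar A₀ A₁ v)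
    (hinv : ¬ HasCommonInvariantSubspace A₀ A₁) :
    affineSpan ℝ (v '' Set.Ico (0 : ℝ) 1) = ⊤ := by
  by_contra hne
  have hmap (A : E →ᵃ[ℝ] E) (hA : A '' (v '' Set.Ico (0 : ℝ) 1) ⊆ v '' Set.Ico (0 : ℝ) 1) :
      ∀ x ∈ affineSpan ℝ (v '' Set.Ico (0 : ℝ) 1),
        A x ∈ affineSpan ℝ (v '' Set.Ico (0 : ℝ) 1) := by
    intro x hx
    have h1 := AffineSubspace.mem_map_of_mem A hx
    rw [AffineSubspace.map_span] at h1
    exact affineSpan_mono ℝ hA h1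
  refine hinv ⟨_, ⟨v 0, subset_affineSpan ℝ _ (Set.mem_image_of_mem v (by simp))⟩, hne, hmap A₀ ?_, hmap A₁ ?_⟩
  · rintro _ ⟨_, ⟨x, ⟨hx0, hx1⟩, rfl⟩, rfl⟩
    refine ⟨x / 2, ⟨by linarith, by linarith⟩, ?_⟩
    rw [hs.1 (x / 2) ⟨by linarith, by linarith⟩, mul_div_cancel₀ x two_ne_zero]
  · rintro _ ⟨_, ⟨x, ⟨hx0, hx1⟩, rfl⟩, rfl⟩
    refine ⟨(1 + x) / 2, ⟨by linarith, by linarith⟩, ?_⟩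
    rw [hs.2 _ ⟨by linarith, by linarith⟩, doubleSubOne_eq (by linarith) (by linarith)]
    congr 2
    ring

variable [FiniteDimensional ℝ E]

theorem negLogTwo_le_holderExponent (h : jointSpectralRadius A₀ A₁ < 1)
    (hs : IsSelfSimilar A₀ A₁ v) (hv : WContinuous v) :
    negLogTwo (jointSpectralRadius A₀ A₁) ≤ holderExponent v := by
  have hpos : (0 : EReal) < negLogTwo (jointSpectralRadius A₀ A₁) := by
    obtain h0 | h0 := (jointSpectralRadius_nonneg A₀ A₁).eq_or_lt
    · simp [negLogTwo, ← h0]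
    · rw [negLogTwo, if_neg h0.ne']
      have := Real.logb_neg one_lt_two h0 h
      exact_mod_cast neg_pos.2 this
  refine le_of_forall_lt_imp_le_of_dense fun c hc => ?_
  -- The maximum with 0 secures `α > 0`, as the definition of the exponent demands.
  obtain ⟨α, hα, hα'⟩ := EReal.lt_iff_exists_real_btwn.1 (max_lt hc hpos)
  have hα0 : 0 < α := by exact_mod_cast (le_max_right c 0).trans_lt hα
  refine ((le_max_left c 0).trans hα.le).trans (le_sSup ⟨α, ⟨hα0, ?_⟩, rfl⟩)
  obtain ⟨C, hC, hCn⟩ := exists_norm_limitCurve_sub_le h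
    (lt_two_rpow_neg_of_lt_negLogTwo (jointSpectralRadius_nonneg A₀ A₁) hα')
  refine ⟨C * 2 ^ α, fun δ hδ => dyadicModulus_le_of_digits hα0 hC (fun x hx y hy k hk => ?_) hδ⟩
  rw [hs.eq_limitCurve h hv hx, hs.eq_limitCurve h hv hy]
  exact hCn k _ _ hk

theorem holderExponent_le_negLogTwo (hs : IsSelfSimilar A₀ A₁ v)
    (hinv : ¬ HasCommonInvariantSubspace A₀ A₁) :
    holderExponent v ≤ negLogTwo (jointSpectralRadius A₀ A₁) := by
  refine sSup_le ?_
  rintro _ ⟨α, ⟨-, C, hC⟩, rfl⟩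
  refine le_negLogTwo_of_le_two_rpow_neg (jointSpectralRadius_nonneg A₀ A₁) ?_
  obtain ⟨C', hC'⟩ := exists_norm_sub_le_of_dyadicModulus_le hC
  set γ : ℝ := 2 ^ (-α)
  have hγ : 0 < γ := by positivity
  have hdiff : ∀ x ∈ Set.Ico (0 : ℝ) 1, ∀ k d,
      ‖wordLinear A₀ A₁ k d (v x - v 0)‖ ≤ C' * γ ^ k := by
    intro x hx k d
    obtain ⟨y, hy, hyd, hyx⟩ := exists_unitDigits_prefix k d hx
    -- Prepending `d` to `x` and to `0` gives two points with a common prefix of length `k`; the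
    -- difference of their values is the product along `d` applied to `v x - v 0`.
    obtain ⟨z, hz, hzd, hz0⟩ := exists_unitDigits_prefix k d (x := 0) (by simp)
    have h1 := applyWord_unitDigits hs (Set.Ico_subset_Icc_self hy) k
    have h2 := applyWord_unitDigits hs (Set.Ico_subset_Icc_self hz) k
    rw [hyx, applyWord_congr A₀ A₁ hyd] at h1
    rw [hz0, applyWord_congr A₀ A₁ hzd] at h2
    rw [← applyWord_sub, ← h1, ← h2]
    exact hC' y (Set.Ico_subset_Icc_self hy) z (Set.Ico_subset_Icc_self hz) k
      fun i hi => (hyd i hi).trans (hzd i hi).symm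
  have hbound : ∀ z : E, ∃ K, ∀ k d, ‖wordLinear A₀ A₁ k d z‖ ≤ K * γ ^ k := by
    intro z
    have hz : z ∈ vectorSpan ℝ (v '' Set.Ico (0 : ℝ) 1) := by
      rw [← direction_affineSpan, hs.affineSpan_eq_top hinv, AffineSubspace.direction_top]
      trivial
    rw [vectorSpan_eq_span_vsub_set_right ℝ (p := v 0) (Set.mem_image_of_mem v (by simp))] at hz
    induction hz using Submodule.span_induction with
    | mem z hz =>
      obtain ⟨_, ⟨x, hx, rfl⟩, rfl⟩ := hz
      exact ⟨C', hdiff x hx⟩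
    | zero => exact ⟨0, by simp⟩
    | add z w _ _ hz hw =>
      obtain ⟨K, hK⟩ := hz
      obtain ⟨L, hL⟩ := hw
      refine ⟨K + L, fun k d => ?_⟩
      rw [map_add, add_mul]
      exact (norm_add_le _ _).trans (add_le_add (hK k d) (hL k d))
    | smul a z _ hz =>
      obtain ⟨K, hK⟩ := hz
      refine ⟨‖a‖ * K, fun k d => ?_⟩
      rw [map_smul, norm_smul, mul_assoc]
      exact mul_le_mul_of_nonneg_left (hK k d) (norm_nonneg a)
  -- The constant in `hbound` depends on the vector; uniform boundedness over all words of all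
  -- lengths turns it into one operator norm bound.
  obtain ⟨K, hK⟩ := banach_steinhaus
    (g := fun p : ℕ × (ℕ → Fin 2) => (γ ^ p.1)⁻¹ • wordLinear A₀ A₁ p.1 p.2) (by
      intro z
      obtain ⟨K, hK⟩ := hbound z
      refine ⟨K, fun p => ?_⟩
      rw [_root_.smul_apply, norm_smul, norm_inv, norm_pow, Real.norm_of_nonneg hγ.le,
        inv_mul_le_iff₀ (by positivity), mul_comm]
      exact hK p.1 p.2)
  refine jointSpectralRadius_le_of_maxProductNorm_le hγ.le (K := K) fun n =>
    maxProductNorm_le fun d => ?_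
  have h1 := hK (n, d)
  rwa [norm_smul, norm_inv, norm_pow, Real.norm_of_nonneg hγ.le,
    inv_mul_le_iff₀ (by positivity), mul_comm] at h1

end Exponent

end

end DyadicCurve

theorem mainTheorem1 (N : ℕ)
    (A₀ A₁ : EuclideanSpace ℝ (Fin N) →ᵃ[ℝ] EuclideanSpace ℝ (Fin N))
    (hρ : DyadicCurve.jointSpectralRadius A₀ A₁ < 1) :
    (∃ v : ℝ → EuclideanSpace ℝ (Fin N),
      DyadicCurve.IsSelfSimilar A₀ A₁ v ∧ DyadicCurve.WContinuous v) ∧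
    ∀ v : ℝ → EuclideanSpace ℝ (Fin N),
      DyadicCurve.IsSelfSimilar A₀ A₁ v → DyadicCurve.WContinuous v →
        DyadicCurve.negLogTwo (DyadicCurve.jointSpectralRadius A₀ A₁) ≤
            DyadicCurve.holderExponent v ∧
          (¬ DyadicCurve.HasCommonInvariantSubspace A₀ A₁ →
            DyadicCurve.holderExponent v =
              DyadicCurve.negLogTwo (DyadicCurve.jointSpectralRadius A₀ A₁)) :=
  ⟨⟨_, DyadicCurve.isSelfSimilar_limitCurve hρ, DyadicCurve.wContinuous_limitCurve hρ⟩,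
    fun _ hs hv => ⟨DyadicCurve.negLogTwo_le_holderExponent hρ hs hv, fun hinv =>
      le_antisymm (DyadicCurve.holderExponent_le_negLogTwo hs hinv)
        (DyadicCurve.negLogTwo_le_holderExponent hρ hs hv)⟩⟩
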